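/- Let $G=(V,E)$ be a finite, undirected, unweighted, connected simple graph with at least two nodes, let $s\in V$ be a source node, $\ell\ge 0$ a walk length, and let $\lambda\ge 1$ and $\eta\ge 1$ be integer parameters. A step of the random walk goes from a node to a uniformly random neighbor. All random choices below are made with independent fresh randomness. Consider the following distributed algorithm Single-Random-Walk$(s,\ell)$. *Phase 1.* Every node $v$ creates $\eta\deg(v)$ coupons carrying its ID, and each of them is forwarded along a random walk of length $\lambda+r$, where the numbers $r$ are independent and uniform in $\{0,\dots,\lambda-1\}$: each coupon carries its desired length, and in the iterations $i=1,\dots,2\lambda$ it is kept where it is if its desired length is at most $i-1$, and otherwise it is forwarded to a random neighbor of the node holding it. *Phase 2.* A token carrying the ID of $s$ starts at $s$, with completed length $0$. While the completed length is at most $\ell-2\lambda$, the node $v$ that holds the token calls Sample-Coupon$(v)$; if no coupon created by $v$ is left in the network, it calls Send-More-Coupons$(v,\eta,\lambda)$ and then Sample-Coupon$(v)$ again. The token is sent to the node $v'$ that holds the sampled coupon $C$, the node $v'$ deletes $C$, and the completed length grows by the number of times $C$ was forwarded. When the loop ends, the token is forwarded to random neighbors until $\ell$ steps are completed, and the node holding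 the token outputs the ID on it; the other nodes output nothing. *Sample-Coupon$(v)$.* A breadth-first-search tree rooted at $v$ is constructed (ties may be broken in any way, possibly at random and depending on the coupons currently in the network). Every node holding coupons created by $v$ picks one of them uniformly at random, with count the number of such coupons it holds. From the last level of the tree up to the root, every node that has its own pick or receives coupons from its children samples one of these coupons with probability proportional to their counts, and sends it to its parent together with the sum of the counts. The coupon sampled at the root is returned. *Send-More-Coupons$(v,\eta,\lambda)$.* The node $v$ creates $\eta$ new coupons, each of which is forwarded to a random neighbor in each of $\lambda$ rounds. Then, for $i=0,\dots,\lambda-1$, each coupon that is still moving is, independently, stopped for good with probability $\frac1{\lambda-i}$ and otherwise forwarded to a random neighbor. Then Single-Random-Walk solves the problem 1-RW-DoS: for every node $v$, the probability that $v$ outputs the ID of $s$ when the algorithm finishes is equal to the probability that $v$ is the destination of a random walk of length $\ell$ started at $s$. -/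

import Mathlib

open scoped ENNReal

/-!
# A distributed algorithm sampling the endpoint of a random walk by stitching short walks

All randomized procedures are programs in the probability monad `PMF`: `PMF.bind` runs one
procedure after the other, with fresh independent randomness in every random choice.
-/

noncomputable section

namespace StitchedWalk

universe u v

/-! ### Elementary random choices -/

/-- Run the random procedure `f a` independently for every entry `a` of a list and collect the
results in order. -/
def drawEach {α : Type u} {β : Type v} (f : α → PMF β) : List α → PMF (List β)
  | [] => PMF.pure []
  | a :: l => (f a).bind fun b => (drawEach f l).map fun bs => b :: bs

/-- A coin that shows `true` with probability `p`. -/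
def coin (p : ℝ≥0∞) (hp : p ≤ 1) : PMF Bool :=
  PMF.ofFintype (fun b => if b then p else 1 - p) (by simp [add_tsub_cancel_of_le hp])

variable {V : Type u} [Fintype V] [DecidableEq V]

/-- One step of the simple random walk: a uniformly random neighbor. (A node without neighbors,
which does not occur in a connected graph with at least two nodes, keeps the walk.) -/
def step (G : SimpleGraph V) [DecidableRel G.Adj] (x : V) : PMF V :=
  if h : (G.neighborFinset x).Nonempty then PMF.uniformOfFinset (G.neighborFinset x) h
  else PMF.pure x

/-- The distribution of the destination of a simple random walk of the given length started at a
given node. -/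
def walk (G : SimpleGraph V) [DecidableRel G.Adj] : ℕ → V → PMF V
  | 0, x => PMF.pure x
  | n + 1, x => (step G x).bind (walk G n)

/-! ### Coupons -/

/-- A coupon: the ID of the node that created it, the node at which it currently is, and the
number of times it has been forwarded. -/
structure Coupon (V : Type u) where
  src : V
  holder : V
  hops : ℕ
deriving DecidableEq

/-- The coupons stored in the network. The coupons stored at the node `x` are those with
`holder = x`; coupons that agree in all their data are indistinguishable. -/
abbrev Network (V : Type u) := Multiset (Coupon V)

/-- The node holding the coupon forwards it to a uniformly random neighbor. -/
def forward (G : SimpleGraph V) [DecidableRel G.Adj] (c : Coupon V) : PMF (Coupon V) :=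
  (step G c.holder).map fun x => ⟨c.src, x, c.hops + 1⟩

/-! ### Phase 1 -/

/-- Every node `x` creates `eta * deg x` coupons; each comes with its desired walk length
`lam + r`, where `r` is uniform in `[0, lam - 1]`. -/
def createCoupons (G : SimpleGraph V) [DecidableRel G.Adj] (lam eta : ℕ) (hlam : 0 < lam) :
    PMF (List (Coupon V × ℕ)) :=
  drawEach
    (fun x => (PMF.uniformOfFinset (Finset.range lam) (Finset.nonempty_range_iff.2 hlam.ne')).map
      fun r => ((⟨x, x, 0⟩ : Coupon V), lam + r))
    ((Finset.univ : Finset V).toList.flatMap fun x => List.replicate (eta * G.degree x) x)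

/-- The `i`-th iteration of the forwarding loop: a coupon whose desired walk length is at most
`i - 1`, the number of steps it can have made before this iteration, is kept where it is; every
other coupon is forwarded to a random neighbor. -/
def phaseOneRound (G : SimpleGraph V) [DecidableRel G.Adj] (i : ℕ) :
    List (Coupon V × ℕ) → PMF (List (Coupon V × ℕ)) :=
  drawEach fun c => if c.2 ≤ i - 1 then PMF.pure c else (forward G c.1).map fun c' => (c', c.2)

/-- The iterations `1, …, n` of the forwarding loop. -/
def phaseOneRounds (G : SimpleGraph V) [DecidableRel G.Adj] :
    ℕ → List (Coupon V × ℕ) → PMF (List (Coupon V × ℕ))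
  | 0, l => PMF.pure l
  | n + 1, l => (phaseOneRounds G n l).bind (phaseOneRound G (n + 1))

/-- Phase 1: create the coupons and run `2 * lam` iterations of the forwarding loop. -/
def phaseOne (G : SimpleGraph V) [DecidableRel G.Adj] (lam eta : ℕ) (hlam : 0 < lam) :
    PMF (Network V) :=
  ((createCoupons G lam eta hlam).bind (phaseOneRounds G (2 * lam))).map
    fun l => (l.map Prod.fst : List (Coupon V))

/-! ### Send-More-Coupons -/

/-- Part 1: forward all the new coupons for `n` rounds. -/
def sendRounds (G : SimpleGraph V) [DecidableRel G.Adj] :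
    ℕ → List (Coupon V) → PMF (List (Coupon V))
  | 0, l => PMF.pure l
  | n + 1, l => (sendRounds G n l).bind (drawEach (forward G))

/-- One iteration of Part 2; the flag of a coupon says whether it has been stopped. Each coupon
that is still moving is stopped with probability `p` and otherwise forwarded once more. -/
def extendRound (G : SimpleGraph V) [DecidableRel G.Adj] (p : ℝ≥0∞) (hp : p ≤ 1) :
    List (Coupon V × Bool) → PMF (List (Coupon V × Bool)) :=
  drawEach fun c =>
    if c.2 then PMF.pure c
    else (coin p hp).bind fun halt =>
      if halt then PMF.pure (c.1, true) else (forward G c.1).map fun c' => (c', false)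

/-- The last `m` iterations of Part 2. Of the iterations `i = 0, …, lam - 1`, the iteration with
`lam - i = m` stops each moving coupon with probability `1 / (lam - i) = 1 / m`. -/
def extendRounds (G : SimpleGraph V) [DecidableRel G.Adj] :
    ℕ → List (Coupon V × Bool) → PMF (List (Coupon V × Bool))
  | 0, l => PMF.pure l
  | m + 1, l =>
      (extendRound G (((m + 1 : ℕ) : ℝ≥0∞)⁻¹)
        (ENNReal.inv_le_one.2 (by exact_mod_cast Nat.succ_le_succ (Nat.zero_le m))) l).bind
        (extendRounds G m)

/-- Send-More-Coupons: the node `x` creates `eta` new coupons, which are forwarded for `lam`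
rounds (Part 1) and then extended probabilistically in `lam` further iterations (Part 2). -/
def sendMoreCoupons (G : SimpleGraph V) [DecidableRel G.Adj] (lam eta : ℕ) (x : V) :
    PMF (Network V) :=
  ((sendRounds G lam (List.replicate eta ⟨x, x, 0⟩)).bind fun l =>
    extendRounds G lam (l.map fun c => (c, false))).map
      fun l => (l.map Prod.fst : List (Coupon V))

/-! ### Sample-Coupon -/

/-- A breadth-first-search tree of `G` rooted at `root`: every other node has a parent, a neighbor
whose distance to the root is smaller by one. -/
structure BFSTree (G : SimpleGraph V) (root : V) where
  parent : V → V
  adj_parent : ∀ x, x ≠ root → G.Adj x (parent x)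
  dist_parent : ∀ x, x ≠ root → G.dist root x = G.dist root (parent x) + 1

/-- Every connected graph has a breadth-first-search tree with any prescribed root. -/
theorem BFSTree.nonempty (G : SimpleGraph V) (hG : G.Connected) (root : V) :
    Nonempty (BFSTree G root) := by
  have key : ∀ x, ∃ y, x ≠ root → G.Adj x y ∧ G.dist root x = G.dist root y + 1 := by
    intro x
    by_cases hx : x = root
    · exact ⟨x, fun h => absurd hx h⟩
    obtain ⟨w, hw⟩ := hG.exists_walk_length_eq_dist x root
    cases w with
    | nil => exact absurd rfl hx
    | @cons _ y _ h p =>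
      refine ⟨y, fun _ => ⟨h, ?_⟩⟩
      have h1 : G.dist y root ≤ p.length := SimpleGraph.dist_le p
      have h2 : G.dist x root ≤ G.dist x y + G.dist y root := hG.dist_triangle
      have h3 : G.dist x y = 1 := SimpleGraph.dist_eq_one_iff_adj.2 h
      rw [SimpleGraph.Walk.length_cons] at hw
      rw [SimpleGraph.dist_comm (u := root) (v := x), SimpleGraph.dist_comm (u := root) (v := y)]
      omega
  choose f hf using key
  exact ⟨⟨f, fun x hx => (hf x hx).1, fun x hx => (hf x hx).2⟩⟩

/-- The children of a node in the tree. -/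
def BFSTree.children {G : SimpleGraph V} {root : V} (T : BFSTree G root) (x : V) : Finset V :=
  Finset.univ.filter fun y => y ≠ root ∧ T.parent y = x

/-- The number of the last level of a breadth-first-search tree rooted at `root`. -/
def depth (G : SimpleGraph V) (root : V) : ℕ := Finset.univ.sup fun x => G.dist root x

/-- The coupons created by `root` that the node `x` holds. -/
def couponsAt (net : Network V) (root x : V) : Network V :=
  net.filter fun c => c.src = root ∧ c.holder = x

/-- A node holding coupons of `root` picks one of them uniformly at random, and the count is the
number of these coupons; a node holding none has nothing to offer. -/
def pickOwn (net : Network V) (root x : V) : PMF (Option (Coupon V × ℕ)) :=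
  if h : couponsAt net root x = 0 then PMF.pure none
  else (PMF.ofMultiset (couponsAt net root x) h).map
    fun c => some (c, Multiset.card (couponsAt net root x))

/-- Sample one of the coupons in a list of coupons with counts, with probabilities proportional
to the counts; the new count is the sum of the counts. There is no result when that sum is `0`. -/
def combine (l : List (Coupon V × ℕ)) : PMF (Option (Coupon V × ℕ)) :=
  if h : ∑' j : Fin l.length, ((l.get j).2 : ℝ≥0∞) = 0 then PMF.pure none
  else (PMF.normalize (fun j : Fin l.length => ((l.get j).2 : ℝ≥0∞)) h
      (by rw [tsum_fintype]; exact ENNReal.sum_ne_top.2 fun j _ => ENNReal.natCast_ne_top _)).map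
    fun j => some ((l.get j).1, (l.map Prod.snd).sum)

/-- The message (a sampled coupon and its count, or nothing) that a node sends to its parent in
the tree, computed from the last level upward. The number `k` is the number of levels below the
level of the node; the nodes of the last level are leaves. -/
def report {G : SimpleGraph V} {root : V} (T : BFSTree G root) (net : Network V) :
    ℕ → V → PMF (Option (Coupon V × ℕ))
  | 0, x => (pickOwn net root x).bind fun own => combine own.toList
  | k + 1, x =>
      (pickOwn net root x).bind fun own =>
        (drawEach (report T net k) (T.children x).toList).bind fun received =>
          combine (own.toList ++ received.reduceOption)

/-- Sample-Coupon: the coupon that is finally sampled at the root of the tree, or `none` when no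
coupon of the root is left in the network. -/
def sampleCoupon {G : SimpleGraph V} {root : V} (T : BFSTree G root) (net : Network V) :
    PMF (Option (Coupon V)) :=
  (report T net (depth G root) root).map fun m => m.map Prod.fst

/-! ### Phase 2 -/

/-- The token: the ID written on it, the node holding it, and the length of the walk completed. -/
structure Token (V : Type u) where
  src : V
  holder : V
  done : ℕ

/-- The token is sent to the node holding the coupon `c`, and this node deletes `c`. -/
def takeCoupon (net : Network V) (t : Token V) (c : Coupon V) : Network V × Token V :=
  (net.erase c, ⟨t.src, c.holder, t.done + c.hops⟩)

/-- One iteration of the stitching loop. The way in which breadth-first-search trees are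
constructed (how ties are broken) is given by `bfs`. The value `none` would mean that no coupon is
found even after Send-More-Coupons. -/
def stitch {G : SimpleGraph V} [DecidableRel G.Adj] (lam eta : ℕ)
    (bfs : Network V → (x : V) → PMF (BFSTree G x)) (net : Network V) (t : Token V) :
    PMF (Option (Network V × Token V)) :=
  ((bfs net t.holder).bind fun T => sampleCoupon T net).bind fun
    | some c => PMF.pure (some (takeCoupon net t c))
    | none =>
        (sendMoreCoupons G lam eta t.holder).bind fun new =>
          ((bfs (net + new) t.holder).bind fun T => sampleCoupon T (net + new)).map
            fun r => r.map (takeCoupon (net + new) t)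

/-- The outputs of all the nodes when the node `x` holds the token at the end: it outputs the ID
`src` written on the token, and the other nodes output nothing. -/
def outputs (src x : V) : V → Option V := fun y => if y = x then some src else none

/-- Phase 2: while the length completed is at most `ell - 2 * lam`, stitch; then walk naively
until `ell` steps are completed, and output. The first argument bounds the number of iterations of
the loop; an execution that fails, or that would need more iterations, ends without any output. -/
def phaseTwo {G : SimpleGraph V} [DecidableRel G.Adj] (ell lam eta : ℕ)
    (bfs : Network V → (x : V) → PMF (BFSTree G x)) :
    ℕ → Network V → Token V → PMF (V → Option V)
  | fuel, net, t =>
    if t.done + 2 * lam ≤ ell then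
      match fuel with
      | 0 => PMF.pure fun _ => none
      | fuel + 1 =>
          (stitch lam eta bfs net t).bind fun
            | some (net', t') => phaseTwo ell lam eta bfs fuel net' t'
            | none => PMF.pure fun _ => none
    else (walk G (ell - t.done) t.holder).map (outputs t.src)

/-- Single-Random-Walk: the joint distribution of the outputs of all the nodes. The loop of
Phase 2 is allowed `ell` iterations (each of them is meant to add at least one step to the walk). -/
def singleRandomWalk {G : SimpleGraph V} [DecidableRel G.Adj] (ell lam eta : ℕ) (hlam : 0 < lam)
    (bfs : Network V → (x : V) → PMF (BFSTree G x)) (s : V) : PMF (V → Option V) :=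
  (phaseOne G lam eta hlam).bind fun net => phaseTwo ell lam eta bfs ell net ⟨s, s, 0⟩

end StitchedWalk

end

/-!
Every coupon is the end of an independent walk whose length is uniform in `[lam, 2 * lam - 1]`: in
Phase 1 by construction, in Send-More-Coupons because a coupon that is stopped with probability
`1 / m` when `m` iterations are left makes a uniform number of extra steps. Merging samples with
probabilities proportional to their counts keeps them uniform, so Sample-Coupon returns a uniform
coupon of the root, whatever the tree is.

Hence the invariant of the stitching loop: given the sources of the coupons left, the coupons are
independent of each other and of the past of the token. Removing a uniform coupon of `x` from such
a network yields a fresh coupon of `x` and an independent network of the same kind, so every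
iteration appends a fresh walk to the walk of the token.
-/

namespace StitchedWalk

/-! ### Expectations -/

section Mean

variable {α β ι : Type*}

/-- The expectation of a nonnegative function under a discrete distribution. Unlike the
distributions themselves, expectations are linear, which is what the computations with uniform
samples of random size need. -/
noncomputable def mean (p : PMF α) (g : α → ℝ≥0∞) : ℝ≥0∞ := ∑' a, p a * g a

theorem mean_pure (a : α) (g : α → ℝ≥0∞) : mean (PMF.pure a) g = g a := by
  rw [mean, tsum_eq_single a fun b hb => by rw [PMF.pure_apply_of_ne _ _ hb, zero_mul],
    PMF.pure_apply_self, one_mul]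

theorem mean_bind (p : PMF α) (f : α → PMF β) (g : β → ℝ≥0∞) :
    mean (p.bind f) g = mean p fun a => mean (f a) g := by
  simp only [mean, PMF.bind_apply, ← ENNReal.tsum_mul_right, ← ENNReal.tsum_mul_left, mul_assoc]
  exact ENNReal.tsum_comm

theorem mean_map (p : PMF α) (f : α → β) (g : β → ℝ≥0∞) :
    mean (p.map f) g = mean p fun a => g (f a) := by
  simp only [← PMF.bind_pure_comp, mean_bind, Function.comp_apply, mean_pure]

theorem mean_const (p : PMF α) (r : ℝ≥0∞) : mean p (fun _ => r) = r := by
  rw [mean, ENNReal.tsum_mul_right, p.tsum_coe, one_mul]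

theorem mean_add (p : PMF α) (g h : α → ℝ≥0∞) :
    mean p (fun a => g a + h a) = mean p g + mean p h := by
  simp only [mean, mul_add, ENNReal.tsum_add]

theorem mean_const_mul (p : PMF α) (r : ℝ≥0∞) (g : α → ℝ≥0∞) :
    mean p (fun a => r * g a) = r * mean p g := by
  simp only [mean, ← ENNReal.tsum_mul_left, mul_left_comm]

theorem mean_multiset_sum (p : PMF α) (s : Multiset ι) (g : ι → α → ℝ≥0∞) :
    mean p (fun a => (s.map fun i => g i a).sum) = (s.map fun i => mean p (g i)).sum := by
  induction s using Multiset.induction_on with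
  | empty => simp only [Multiset.map_zero, Multiset.sum_zero, mean_const]
  | cons i s ih => simp only [Multiset.map_cons, Multiset.sum_cons, mean_add, ih]

theorem mean_sum (p : PMF α) (s : Finset ι) (g : ι → α → ℝ≥0∞) :
    mean p (fun a => ∑ i ∈ s, g i a) = ∑ i ∈ s, mean p (g i) :=
  mean_multiset_sum p s.val g

theorem mean_comm (p : PMF α) (q : PMF β) (g : α → β → ℝ≥0∞) :
    (mean p fun a => mean q fun b => g a b) = mean q fun b => mean p fun a => g a b := by
  simp only [mean, ← ENNReal.tsum_mul_left]
  rw [ENNReal.tsum_comm]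
  simp only [mul_left_comm]

theorem mean_congr {p : PMF α} {g h : α → ℝ≥0∞} (hgh : ∀ a ∈ p.support, g a = h a) :
    mean p g = mean p h := by
  refine tsum_congr fun a => ?_
  by_cases ha : p a = 0
  · simp only [ha, zero_mul]
  · rw [hgh a ((p.mem_support_iff a).2 ha)]

theorem ext_mean {p q : PMF α} (h : ∀ g, mean p g = mean q g) : p = q := by
  classical
  have apply_eq_mean (r : PMF α) (a : α) : r a = mean r fun b => if b = a then 1 else 0 := by
    simp only [mean, mul_ite, mul_one, mul_zero, tsum_ite_eq]
  ext a
  rw [apply_eq_mean p, h, ← apply_eq_mean]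

theorem bind_congr_of_mem_support {p : PMF α} {f g : α → PMF β}
    (hfg : ∀ a ∈ p.support, f a = g a) : p.bind f = p.bind g :=
  ext_mean fun h => by
    simp only [mean_bind]
    exact mean_congr fun a ha => by rw [hfg a ha]

theorem mean_uniformOfFinset (s : Finset α) (hs : s.Nonempty) (g : α → ℝ≥0∞) :
    mean (PMF.uniformOfFinset s hs) g = (s.card : ℝ≥0∞)⁻¹ * ∑ a ∈ s, g a := by
  rw [mean, tsum_eq_sum fun a ha => by rw [PMF.uniformOfFinset_apply_of_notMem hs ha, zero_mul],
    Finset.mul_sum]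
  exact Finset.sum_congr rfl fun a ha => by rw [PMF.uniformOfFinset_apply_of_mem hs ha]

theorem mean_ofMultiset (s : Multiset α) (hs : s ≠ 0) (g : α → ℝ≥0∞) :
    mean (PMF.ofMultiset s hs) g = (s.card : ℝ≥0∞)⁻¹ * (s.map g).sum := by
  classical
  rw [mean, tsum_eq_sum (s := s.toFinset) fun a ha => by
    rw [PMF.ofMultiset_apply_of_notMem hs (mt Multiset.mem_toFinset.2 ha), zero_mul],
    Finset.sum_multiset_map_count, Finset.mul_sum]
  refine Finset.sum_congr rfl fun a _ => ?_
  rw [PMF.ofMultiset_apply, nsmul_eq_mul, div_eq_mul_inv]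
  ring

theorem mean_coin (p : ℝ≥0∞) (hp : p ≤ 1) (g : Bool → ℝ≥0∞) :
    mean (coin p hp) g = p * g true + (1 - p) * g false := by
  simp [mean, tsum_fintype, coin, PMF.ofFintype_apply]

theorem natCast_inv_mul_cancel_left {n : ℕ} (hn : n ≠ 0) (r : ℝ≥0∞) :
    (n : ℝ≥0∞)⁻¹ * (n * r) = r :=
  ENNReal.inv_mul_cancel_left' (fun h => absurd (Nat.cast_eq_zero.1 h) hn)
    fun h => absurd h (ENNReal.natCast_ne_top n)

end Mean

/-! ### Independent repetitions -/

section DrawEach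

variable {α β γ : Type*}

theorem drawEach_bind (f : α → PMF β) (g : β → PMF γ) (l : List α) :
    (drawEach f l).bind (drawEach g) = drawEach (fun a => (f a).bind g) l := by
  induction l with
  | nil => exact PMF.pure_bind _ _
  | cons a l ih =>
    simp only [drawEach, PMF.bind_bind, PMF.bind_map, Function.comp_def, ← ih]
    refine congrArg _ (funext fun b => ?_)
    rw [PMF.bind_comm]
    simp only [PMF.map_bind]

theorem drawEach_pure_comp (g : α → β) (l : List α) :
    drawEach (fun a => PMF.pure (g a)) l = PMF.pure (l.map g) := by
  induction l with
  | nil => rfl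
  | cons a l ih => simp only [drawEach, ih, PMF.pure_bind, PMF.pure_map, List.map_cons]

theorem drawEach_pure (l : List α) : drawEach PMF.pure l = PMF.pure l :=
  (drawEach_pure_comp id l).trans (congrArg PMF.pure l.map_id)

theorem drawEach_map (f : α → β) (g : β → PMF γ) (l : List α) :
    drawEach g (l.map f) = drawEach (fun a => g (f a)) l := by
  induction l with
  | nil => rfl
  | cons a l ih => simp only [List.map_cons, drawEach, ih]

theorem map_drawEach (f : α → PMF β) (g : β → γ) (l : List α) :
    (drawEach f l).map (List.map g) = drawEach (fun a => (f a).map g) l := by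
  simp only [← PMF.bind_pure_comp, Function.comp_def, ← drawEach_bind, ← drawEach_pure_comp]

end DrawEach

section DrawMultiset

variable {ι α : Type*}

/-- Add a sample of `f i` to a random multiset that is independent of it. -/
noncomputable def drawCons (f : ι → PMF α) (i : ι) (q : PMF (Multiset α)) : PMF (Multiset α) :=
  (f i).bind fun a => q.map (a ::ₘ ·)

instance (f : ι → PMF α) : LeftCommutative (drawCons f) where
  left_comm i j q := by
    simp only [drawCons, PMF.map_bind, PMF.map_comp, Function.comp_def]
    rw [PMF.bind_comm]
    simp only [Multiset.cons_swap]

/-- The multiset of independent samples of `f i`, one for every entry `i` of a multiset: the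
unordered version of `drawEach`. -/
noncomputable def drawMultiset (f : ι → PMF α) (s : Multiset ι) : PMF (Multiset α) :=
  s.foldr (drawCons f) (PMF.pure 0)

theorem drawMultiset_zero (f : ι → PMF α) : drawMultiset f 0 = PMF.pure 0 := rfl

theorem drawMultiset_cons (f : ι → PMF α) (i : ι) (s : Multiset ι) :
    drawMultiset f (i ::ₘ s) = (f i).bind fun a => (drawMultiset f s).map (a ::ₘ ·) :=
  Multiset.foldr_cons _ _ _ _

theorem drawMultiset_add (f : ι → PMF α) (s s' : Multiset ι) :
    drawMultiset f (s + s') =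
      (drawMultiset f s).bind fun t => (drawMultiset f s').map (t + ·) := by
  induction s using Multiset.induction_on with
  | empty =>
    simp only [drawMultiset_zero, PMF.pure_bind, zero_add]
    exact (PMF.map_id _).symm
  | cons i s ih =>
    simp only [Multiset.cons_add, drawMultiset_cons, ih, PMF.bind_bind, PMF.map_bind, PMF.bind_map,
      PMF.map_comp, Function.comp_def]

theorem map_coe_drawEach (f : ι → PMF α) (l : List ι) :
    (drawEach f l).map Multiset.ofList = drawMultiset f l := by
  induction l with
  | nil => exact PMF.pure_map _ _
  | cons i l ih =>
    simp only [drawEach, PMF.map_bind, PMF.map_comp, ← Multiset.cons_coe, drawMultiset_cons, ← ih,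
      Function.comp_def]

theorem map_tag_of_mem_support_drawMultiset {f : ι → PMF α} {tag : α → ι}
    (hf : ∀ i, ∀ a ∈ (f i).support, tag a = i) {s : Multiset ι} {t : Multiset α}
    (ht : t ∈ (drawMultiset f s).support) : t.map tag = s := by
  induction s using Multiset.induction_on generalizing t with
  | empty =>
    rw [drawMultiset_zero, PMF.mem_support_pure_iff] at ht
    rw [ht, Multiset.map_zero]
  | cons i s ih =>
    simp only [drawMultiset_cons, PMF.mem_support_bind_iff, PMF.mem_support_map_iff] at ht
    obtain ⟨a, ha, t', ht', rfl⟩ := ht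
    rw [Multiset.map_cons, hf i a ha, ih ht']

theorem card_filter_tag_of_mem_support_drawMultiset [DecidableEq ι] {f : ι → PMF α}
    {tag : α → ι} (hf : ∀ i, ∀ a ∈ (f i).support, tag a = i) (i : ι) {s : Multiset ι}
    {t : Multiset α} (ht : t ∈ (drawMultiset f s).support) :
    (t.filter fun a => tag a = i).card = s.count i := by
  simp only [← map_tag_of_mem_support_drawMultiset hf ht, Multiset.count_map, eq_comm]

theorem sum_map_filter {M : Type*} [AddCommMonoid M] (p : α → Prop) [DecidablePred p] (f : α → M)
    (t : Multiset α) : ((t.filter p).map f).sum = (t.map fun a => if p a then f a else 0).sum := by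
  induction t using Multiset.induction_on with
  | empty => rfl
  | cons a t ih => by_cases ha : p a <;> simp [ha, ih]

variable [DecidableEq ι] [DecidableEq α]

/-- This is Mecke's formula for the point process `drawMultiset f s`. -/
theorem mean_drawMultiset_sum_erase (f : ι → PMF α) (s : Multiset ι)
    (F : α → Multiset α → ℝ≥0∞) :
    mean (drawMultiset f s) (fun t => (t.map fun a => F a (t.erase a)).sum) =
      (s.map fun i => mean (f i) fun a => mean (drawMultiset f (s.erase i)) (F a)).sum := by
  induction s using Multiset.induction_on generalizing F with
  | empty => simp only [drawMultiset_zero, mean_pure, Multiset.map_zero, Multiset.sum_zero]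
  | cons j s ih =>
    have sum_cons (b : α) (t : Multiset α) :
        (((b ::ₘ t).map fun a => F a ((b ::ₘ t).erase a)).sum) =
          F b t + (t.map fun a => F a (b ::ₘ t.erase a)).sum := by
      rw [Multiset.map_cons, Multiset.sum_cons, Multiset.erase_cons_head]
      refine congrArg (F b t + Multiset.sum ·) (Multiset.map_congr rfl fun a ha => ?_)
      rw [Multiset.erase_cons_tail_of_mem ha]
    have mean_cons (i : ι) (hi : i ∈ s) :
        (mean (f i) fun a => mean (drawMultiset f ((j ::ₘ s).erase i)) (F a)) =
          mean (f j) fun b => mean (f i) fun a =>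
            mean (drawMultiset f (s.erase i)) fun t => F a (b ::ₘ t) := by
      rw [Multiset.erase_cons_tail_of_mem hi]
      simp only [drawMultiset_cons, mean_bind, mean_map]
      exact mean_comm _ _ _
    have ih_cons (b : α) := ih fun a t => F a (b ::ₘ t)
    rw [Multiset.map_cons, Multiset.sum_cons, Multiset.erase_cons_head,
      Multiset.map_congr rfl mean_cons, ← mean_multiset_sum, ← mean_add, drawMultiset_cons,
      mean_bind]
    simp only [mean_map, sum_cons, mean_add, ih_cons]

theorem mean_drawMultiset_sum_filter_erase {f : ι → PMF α} {tag : α → ι}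
    (hf : ∀ i, ∀ a ∈ (f i).support, tag a = i) (s : Multiset ι) (i : ι)
    (F : α → Multiset α → ℝ≥0∞) :
    mean (drawMultiset f s)
        (fun t => ((t.filter fun a => tag a = i).map fun a => F a (t.erase a)).sum) =
      s.count i * mean (f i) fun a => mean (drawMultiset f (s.erase i)) (F a) := by
  have mean_other (j : ι) (hj : j ≠ i) (_ : j ∈ s) :
      (mean (f j) fun a => mean (drawMultiset f (s.erase j))
        fun t => if tag a = i then F a t else 0) = 0 := by
    rw [← mean_const (f j) 0]
    refine mean_congr fun a ha => ?_
    simp only [hf j a ha, if_neg hj, mean_const]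
  simp only [sum_map_filter]
  rw [mean_drawMultiset_sum_erase f s fun a t => if tag a = i then F a t else 0,
    Multiset.sum_map_eq_nsmul_single i mean_other, nsmul_eq_mul]
  refine congrArg _ (mean_congr fun a ha => ?_)
  simp only [hf i a ha, if_true]

end DrawMultiset

/-! ### Uniform samples -/

section UniformPick

variable {α : Type*} [DecidableEq α]

/-- A uniformly random element of a multiset, or `none` if the multiset is empty. -/
noncomputable def uniformPick (s : Multiset α) : PMF (Option α) :=
  if h : s = 0 then PMF.pure none else (PMF.ofMultiset s h).map some

theorem uniformPick_zero : uniformPick (0 : Multiset α) = PMF.pure none := dif_pos rfl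

theorem mean_uniformPick (s : Multiset α) (g : Option α → ℝ≥0∞) :
    mean (uniformPick s) g =
      if s = 0 then g none else (s.card : ℝ≥0∞)⁻¹ * (s.map fun a => g (some a)).sum := by
  unfold uniformPick
  split_ifs
  · rw [mean_pure]
  · rw [mean_map, mean_ofMultiset]

/-- The number of elements with tag `i` is not random, so the normalizing factor of the uniform
pick can be taken out of the expectation and Mecke's formula applies. -/
theorem drawMultiset_bind_uniformPick {ι β : Type*} [DecidableEq ι] {f : ι → PMF α} {tag : α → ι}
    (hf : ∀ i, ∀ a ∈ (f i).support, tag a = i) {s : Multiset ι} {i : ι} (hi : i ∈ s)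
    (k : Option α → Multiset α → PMF β) (k' : α → Multiset α → PMF β)
    (hk : ∀ a t, k (some a) t = k' a (t.erase a)) :
    ((drawMultiset f s).bind fun t =>
        (uniformPick (t.filter fun a => tag a = i)).bind fun o => k o t) =
      (f i).bind fun a => (drawMultiset f (s.erase i)).bind (k' a) := by
  have hcount : s.count i ≠ 0 := Multiset.count_ne_zero.2 hi
  refine ext_mean fun g => ?_
  simp only [mean_bind]
  rw [← natCast_inv_mul_cancel_left hcount (mean (f i) _),
    ← mean_drawMultiset_sum_filter_erase hf s i fun a t => mean (k' a t) g, ← mean_const_mul]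
  refine mean_congr fun t ht => ?_
  have hcard := card_filter_tag_of_mem_support_drawMultiset hf i ht
  have hne : (t.filter fun a => tag a = i) ≠ 0 := by
    rwa [ne_eq, ← Multiset.card_eq_zero, hcard]
  simp only [mean_uniformPick, if_neg hne, hcard, hk]

/-- A uniformly random element of a multiset together with the size of the multiset. -/
noncomputable def uniformCounted (s : Multiset α) : PMF (Option (α × ℕ)) :=
  (uniformPick s).map (Option.map fun a => (a, s.card))

theorem map_fst_uniformCounted (s : Multiset α) :
    (uniformCounted s).map (Option.map Prod.fst) = uniformPick s := by
  have fst_comp : Option.map Prod.fst ∘ Option.map (fun a : α => (a, s.card)) = id := by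
    funext o
    cases o <;> rfl
  rw [uniformCounted, PMF.map_comp, fst_comp, PMF.map_id]

theorem mean_uniformCounted (s : Multiset α) (g : Option (α × ℕ) → ℝ≥0∞) :
    mean (uniformCounted s) g = if s = 0 then g none else
      (s.card : ℝ≥0∞)⁻¹ * (s.map fun a => g (some (a, s.card))).sum := by
  simp only [uniformCounted, mean_map, mean_uniformPick, Option.map_none, Option.map_some]

/-- The total value of a function on the entries of a list, each taken with its count. -/
noncomputable def countedSum {β : Type*} (h : β → ℝ≥0∞) (l : List (β × ℕ)) : ℝ≥0∞ :=
  (l.map fun c => (c.2 : ℝ≥0∞) * h c.1).sum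

theorem toList_append_reduceOption {β : Type*} (o : Option β) (r : List (Option β)) :
    o.toList ++ r.reduceOption = (o :: r).reduceOption := by
  cases o <;> rfl

theorem mean_uniformCounted_countedSum (h : α → ℝ≥0∞) (s : Multiset α) :
    mean (uniformCounted s) (fun o => countedSum h o.toList) = (s.map h).sum := by
  rw [mean_uniformCounted]
  split_ifs with hs
  · simp [countedSum, hs]
  · simp only [countedSum, Option.toList_some, List.map_cons, List.map_nil, List.sum_singleton]
    rw [Multiset.sum_map_mul_left, natCast_inv_mul_cancel_left (Multiset.card_eq_zero.not.2 hs)]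

theorem mean_drawEach_uniformCounted_countedSum (h : α → ℝ≥0∞) (l : List (Multiset α)) :
    mean (drawEach uniformCounted l) (fun r => countedSum h r.reduceOption) =
      (l.sum.map h).sum := by
  induction l with
  | nil => simp [drawEach, mean_pure, countedSum]
  | cons s l ih =>
    have countedSum_cons (o : Option (α × ℕ)) (r : List (Option (α × ℕ))) :
        countedSum h (o :: r).reduceOption =
          countedSum h o.toList + countedSum h r.reduceOption := by
      rw [← toList_append_reduceOption, countedSum, List.map_append, List.sum_append]
      rfl
    simp only [drawEach, mean_bind, mean_map, countedSum_cons, mean_add, mean_const, ih,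
      mean_uniformCounted_countedSum, List.sum_cons, Multiset.map_add, Multiset.sum_add]

theorem sum_counts_of_mem_support_uniformCounted {s : Multiset α} {o : Option (α × ℕ)}
    (ho : o ∈ (uniformCounted s).support) : (o.toList.map Prod.snd).sum = s.card := by
  unfold uniformCounted uniformPick at ho
  split_ifs at ho with hs
  · rw [PMF.pure_map, PMF.mem_support_pure_iff] at ho
    simp [ho, hs]
  · rw [PMF.map_comp] at ho
    obtain ⟨a, -, rfl⟩ := (PMF.mem_support_map_iff _ _ _).1 ho
    simp

theorem sum_counts_of_mem_support_drawEach_uniformCounted {l : List (Multiset α)}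
    {r : List (Option (α × ℕ))} (hr : r ∈ (drawEach uniformCounted l).support) :
    (r.reduceOption.map Prod.snd).sum = l.sum.card := by
  induction l generalizing r with
  | nil =>
    rw [drawEach, PMF.mem_support_pure_iff] at hr
    simp [hr]
  | cons s l ih =>
    simp only [drawEach, PMF.mem_support_bind_iff, PMF.mem_support_map_iff] at hr
    obtain ⟨o, ho, r, hr, rfl⟩ := hr
    rw [← toList_append_reduceOption, List.map_append, List.sum_append, ih hr,
      sum_counts_of_mem_support_uniformCounted ho, List.sum_cons, Multiset.card_add]

end UniformPick

/-! ### Sample-Coupon -/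

section Combine

variable {V : Type*}

theorem tsum_get_snd {α : Type*} (l : List (α × ℕ)) :
    ∑' j : Fin l.length, ((l.get j).2 : ℝ≥0∞) = ((l.map Prod.snd).sum : ℕ) := by
  rw [tsum_fintype, ← Nat.cast_sum, ← List.sum_ofFn]
  congr 2
  exact List.ext_getElem (by simp) (by simp)

theorem mean_combine (l : List (Coupon V × ℕ)) (g : Option (Coupon V × ℕ) → ℝ≥0∞) :
    mean (combine l) g = if (l.map Prod.snd).sum = 0 then g none else
      ((l.map Prod.snd).sum : ℝ≥0∞)⁻¹ *
        countedSum (fun c => g (some (c, (l.map Prod.snd).sum))) l := by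
  unfold combine
  by_cases h : (l.map Prod.snd).sum = 0
  · rw [dif_pos (by rw [tsum_get_snd, h, Nat.cast_zero]), if_pos h, mean_pure]
  · rw [dif_neg (by rw [tsum_get_snd]; exact_mod_cast h), if_neg h, mean_map, mean]
    simp only [PMF.normalize_apply, tsum_get_snd]
    rw [tsum_fintype, countedSum, Finset.sum_congr rfl fun j _ => mul_right_comm _ _ _,
      ← Finset.sum_mul, mul_comm, ← List.sum_ofFn]
    congr 2
    exact List.ext_getElem (by simp) (by simp)

theorem drawEach_uniformCounted_bind_combine [DecidableEq V] (l : List (Network V)) :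
    ((drawEach uniformCounted l).bind fun r => combine r.reduceOption) = uniformCounted l.sum := by
  refine ext_mean fun g => ?_
  have mean_combine_of_mem_support (r) (hr : r ∈ (drawEach uniformCounted l).support) :
      mean (combine r.reduceOption) g =
        if l.sum = 0 then g none else (l.sum.card : ℝ≥0∞)⁻¹ *
          countedSum (fun c => g (some (c, l.sum.card))) r.reduceOption := by
    simp only [mean_combine, sum_counts_of_mem_support_drawEach_uniformCounted hr,
      Multiset.card_eq_zero]
  rw [mean_bind, mean_congr mean_combine_of_mem_support, mean_uniformCounted]
  split_ifs
  · rw [mean_const]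
  · rw [mean_const_mul, mean_drawEach_uniformCounted_countedSum]

theorem pickOwn_eq [DecidableEq V] (net : Network V) (root x : V) :
    pickOwn net root x = uniformCounted (couponsAt net root x) := by
  unfold pickOwn uniformCounted uniformPick
  split_ifs
  · rw [PMF.pure_map, Option.map_none]
  · rw [PMF.map_comp]
    rfl

end Combine

section Tree

theorem BFSTree.dist_eq_zero_iff {V : Type*} {G : SimpleGraph V} {root : V}
    (T : BFSTree G root) (x : V) : G.dist root x = 0 ↔ x = root := by
  refine ⟨fun h => by_contra fun hx => ?_, fun h => h ▸ SimpleGraph.dist_self⟩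
  have := T.dist_parent x hx
  omega

variable {V : Type*} [Fintype V] [DecidableEq V] {G : SimpleGraph V} {root : V}
  (T : BFSTree G root) {M : Type*} [AddCommMonoid M] (f : V → M)

/-- The sum of `f` over a node and its descendants in the tree, down to `k` levels below it. -/
def BFSTree.descendantSum : ℕ → V → M
  | 0, x => f x
  | k + 1, x => f x + ∑ y ∈ T.children x, descendantSum k y

theorem BFSTree.sum_children_level (n : ℕ) :
    ∑ x with G.dist root x = n, ∑ y ∈ T.children x, f y = ∑ y with G.dist root y = n + 1, f y := by
  have ne_root {y : V} (hy : G.dist root y = n + 1) : y ≠ root := fun h => by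
    rw [(T.dist_eq_zero_iff y).2 h] at hy
    omega
  have parent_level : ∀ y ∈ ({y | G.dist root y = n + 1} : Finset V),
      T.parent y ∈ ({x | G.dist root x = n} : Finset V) := fun y hy => by
    rw [Finset.mem_filter_univ] at hy ⊢
    have := T.dist_parent y (ne_root hy)
    omega
  have children_eq (x : V) (hx : x ∈ ({x | G.dist root x = n} : Finset V)) :
      T.children x = ({y | G.dist root y = n + 1} : Finset V).filter fun y => T.parent y = x := by
    ext y
    simp only [BFSTree.children, Finset.mem_filter, Finset.mem_univ, true_and] at hx ⊢
    refine and_congr_left fun hyx => ⟨fun hy => ?_, ne_root⟩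
    rw [T.dist_parent y hy, hyx, hx]
  rw [← Finset.sum_fiberwise_of_maps_to parent_level]
  exact Finset.sum_congr rfl fun x hx => by rw [children_eq x hx]

theorem BFSTree.sum_descendantSum_level (k n : ℕ) :
    ∑ x with G.dist root x = n, T.descendantSum f k x =
      ∑ x with n ≤ G.dist root x ∧ G.dist root x ≤ n + k, f x := by
  induction k generalizing n with
  | zero =>
    refine Finset.sum_congr (Finset.filter_congr fun x _ => ?_) fun x _ => rfl
    omega
  | succ k ih =>
    simp only [BFSTree.descendantSum]
    rw [Finset.sum_add_distrib, T.sum_children_level, ih, ← Finset.sum_union]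
    · refine Finset.sum_congr ?_ fun x _ => rfl
      ext x
      simp only [Finset.mem_union, Finset.mem_filter_univ]
      omega
    · rw [Finset.disjoint_filter]
      omega

theorem BFSTree.descendantSum_depth_root :
    T.descendantSum f (depth G root) root = ∑ x, f x := by
  have hroot : ({x | G.dist root x = 0} : Finset V) = {root} := by
    ext x
    rw [Finset.mem_filter_univ, T.dist_eq_zero_iff, Finset.mem_singleton]
  have hsum := T.sum_descendantSum_level f (depth G root) 0
  rwa [hroot, Finset.sum_singleton, Finset.filter_true_of_mem fun x hx =>
    ⟨Nat.zero_le _, (Finset.le_sup (f := fun x => G.dist root x) hx).trans_eq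
      (Nat.zero_add _).symm⟩] at hsum

theorem report_eq (net : Network V) (k : ℕ) (x : V) :
    report T net k x = uniformCounted (T.descendantSum (couponsAt net root) k x) := by
  induction k generalizing x with
  | zero =>
    have merge := drawEach_uniformCounted_bind_combine [couponsAt net root x]
    simp only [drawEach, PMF.pure_map, PMF.bind_bind, PMF.pure_bind, ← toList_append_reduceOption,
      List.reduceOption_nil, List.append_nil, List.sum_singleton] at merge
    simp only [report, pickOwn_eq, merge, BFSTree.descendantSum]
  | succ k ih =>
    have merge := drawEach_uniformCounted_bind_combine (couponsAt net root x ::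
      (T.children x).toList.map (T.descendantSum (couponsAt net root) k))
    simp only [drawEach, PMF.bind_bind, PMF.bind_map, Function.comp_def,
      ← toList_append_reduceOption, drawEach_map, List.sum_cons, Finset.sum_map_toList] at merge
    simp only [report, pickOwn_eq, funext ih, merge, BFSTree.descendantSum]

theorem sum_couponsAt (net : Network V) (root : V) :
    ∑ x, couponsAt net root x = net.filter fun c => c.src = root := by
  ext c
  rw [Multiset.count_sum']
  by_cases hc : c.src = root <;> simp [couponsAt, Multiset.count_filter, hc]

theorem sampleCoupon_eq (net : Network V) :
    sampleCoupon T net = uniformPick (net.filter fun c => c.src = root) := by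
  rw [sampleCoupon, report_eq, T.descendantSum_depth_root, sum_couponsAt, map_fst_uniformCounted]

theorem bfs_bind_sampleCoupon (bfs : Network V → (x : V) → PMF (BFSTree G x))
    (net : Network V) (x : V) :
    ((bfs net x).bind fun T => sampleCoupon T net) =
      uniformPick (net.filter fun c => c.src = x) := by
  simp only [sampleCoupon_eq, PMF.bind_const]

end Tree

/-! ### The walks of the coupons -/

section Walks

variable {V : Type*} [Fintype V] (G : SimpleGraph V) [DecidableRel G.Adj]

theorem walk_add (m n : ℕ) (x : V) : walk G (m + n) x = (walk G m x).bind (walk G n) := by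
  induction m generalizing x with
  | zero => rw [Nat.zero_add, walk, PMF.pure_bind]
  | succ m ih => rw [Nat.succ_add, walk, walk, PMF.bind_bind, funext ih]

theorem walk_one (x : V) : walk G 1 x = step G x := PMF.bind_pure _

/-- Forward a coupon `n` times. -/
noncomputable def forwards (n : ℕ) (c : Coupon V) : PMF (Coupon V) :=
  (walk G n c.holder).map fun y => ⟨c.src, y, c.hops + n⟩

theorem forwards_zero (c : Coupon V) : forwards G 0 c = PMF.pure c := PMF.pure_map _ _

theorem forwards_one (c : Coupon V) : forwards G 1 c = forward G c := by
  rw [forwards, walk_one, forward]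

theorem forwards_add (m n : ℕ) (c : Coupon V) :
    forwards G (m + n) c = (forwards G m c).bind (forwards G n) := by
  simp only [forwards, walk_add, PMF.map_bind, PMF.bind_map, Function.comp_def, Nat.add_assoc]

theorem forwards_succ (n : ℕ) (c : Coupon V) :
    forwards G (n + 1) c = (forwards G n c).bind (forward G) := by
  rw [forwards_add, funext (forwards_one G)]

theorem forwards_succ' (n : ℕ) (c : Coupon V) :
    forwards G (n + 1) c = (forward G c).bind (forwards G n) := by
  rw [Nat.add_comm, forwards_add, forwards_one]

/-- The distribution of a coupon created by `x` at the end of its walk, whose length is uniform in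
`[lam, 2 * lam - 1]`. -/
noncomputable def couponLaw (lam : ℕ) (hlam : 0 < lam) (x : V) : PMF (Coupon V) :=
  (PMF.uniformOfFinset (Finset.range lam) (Finset.nonempty_range_iff.2 hlam.ne')).bind
    fun r => forwards G (lam + r) ⟨x, x, 0⟩

theorem mean_couponLaw (lam : ℕ) (hlam : 0 < lam) (x : V) (g : Coupon V → ℝ≥0∞) :
    mean (couponLaw G lam hlam x) g = (lam : ℝ≥0∞)⁻¹ *
      ∑ r ∈ Finset.range lam, mean (forwards G (lam + r) ⟨x, x, 0⟩) g := by
  rw [couponLaw, mean_bind, mean_uniformOfFinset, Finset.card_range]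

theorem src_of_mem_support_couponLaw (lam : ℕ) (hlam : 0 < lam) (x : V) (c : Coupon V)
    (hc : c ∈ (couponLaw G lam hlam x).support) : c.src = x := by
  simp only [couponLaw, forwards, PMF.mem_support_bind_iff, PMF.mem_support_map_iff] at hc
  obtain ⟨r, -, y, -, rfl⟩ := hc
  rfl

theorem le_hops_of_mem_support_couponLaw (lam : ℕ) (hlam : 0 < lam) (x : V) (c : Coupon V)
    (hc : c ∈ (couponLaw G lam hlam x).support) : lam ≤ c.hops := by
  simp only [couponLaw, forwards, PMF.mem_support_bind_iff, PMF.mem_support_map_iff] at hc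
  obtain ⟨r, -, y, -, rfl⟩ := hc
  exact (Nat.le_add_right lam r).trans_eq (Nat.zero_add _).symm

theorem couponLaw_bind_walk (lam : ℕ) (hlam : 0 < lam) (x : V) {n : ℕ} (hn : 2 * lam ≤ n) :
    ((couponLaw G lam hlam x).bind fun c => walk G (n - c.hops) c.holder) = walk G n x := by
  have walk_split (r : ℕ) (hr : r < lam) :
      ((forwards G (lam + r) ⟨x, x, 0⟩).bind fun c => walk G (n - c.hops) c.holder) =
        walk G n x := by
    simp only [forwards, PMF.bind_map, Function.comp_def, Nat.zero_add]
    rw [← walk_add, Nat.add_sub_of_le (by omega)]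
  rw [couponLaw, PMF.bind_bind]
  refine (bind_congr_of_mem_support fun r hr => walk_split r ?_).trans (PMF.bind_const _ _)
  rwa [PMF.mem_support_uniformOfFinset_iff, Finset.mem_range] at hr

theorem phaseOneRounds_eq (n : ℕ) (l : List (Coupon V × ℕ)) :
    phaseOneRounds G n l =
      drawEach (fun c => (forwards G (min n c.2) c.1).map fun c' => (c', c.2)) l := by
  induction n with
  | zero =>
    simp only [phaseOneRounds, Nat.zero_min, forwards_zero, PMF.pure_map]
    exact (drawEach_pure l).symm
  | succ n ih =>
    rw [phaseOneRounds, ih, phaseOneRound, drawEach_bind]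
    congr 1
    funext c
    simp only [PMF.bind_map, Function.comp_def, Nat.add_sub_cancel]
    by_cases h : c.2 ≤ n
    · simp only [if_pos h, min_eq_right h, min_eq_right (h.trans n.le_succ)]
      exact PMF.bind_pure_comp _ _
    · simp only [if_neg h]
      rw [not_le] at h
      simp only [min_eq_left h.le, min_eq_left (Nat.succ_le_of_lt h), forwards_succ, PMF.map_bind]

theorem phaseOne_eq (lam eta : ℕ) (hlam : 0 < lam) :
    phaseOne G lam eta hlam = drawMultiset (couponLaw G lam hlam)
      ((Finset.univ : Finset V).toList.flatMap fun x => List.replicate (eta * G.degree x) x) := by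
  have coupon_eq (x : V) :
      (((PMF.uniformOfFinset (Finset.range lam) (Finset.nonempty_range_iff.2 hlam.ne')).map
          fun r => ((⟨x, x, 0⟩ : Coupon V), lam + r)).bind fun c =>
        (forwards G (min (2 * lam) c.2) c.1).map fun c' => (c', c.2)).map Prod.fst =
      couponLaw G lam hlam x := by
    simp only [PMF.bind_map, PMF.map_bind, PMF.map_comp, Function.comp_def]
    refine bind_congr_of_mem_support fun r hr => ?_
    rw [PMF.mem_support_uniformOfFinset_iff, Finset.mem_range] at hr
    rw [min_eq_right (by omega)]
    exact PMF.map_id _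
  rw [phaseOne, createCoupons, funext (phaseOneRounds_eq G (2 * lam)), drawEach_bind,
    ← map_coe_drawEach, ← funext coupon_eq, ← map_drawEach, PMF.map_comp]
  rfl

theorem sendRounds_eq (n : ℕ) (l : List (Coupon V)) :
    sendRounds G n l = drawEach (forwards G n) l := by
  induction n with
  | zero => rw [sendRounds, funext (forwards_zero G), drawEach_pure]
  | succ n ih => rw [sendRounds, ih, drawEach_bind, funext (forwards_succ G n)]

/-- The last `m` iterations of the probabilistic extension, for a single coupon with its flag. -/
noncomputable def extendOne : ℕ → Coupon V × Bool → PMF (Coupon V × Bool)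
  | 0, c => PMF.pure c
  | m + 1, c =>
      (if c.2 then PMF.pure c
        else (coin (((m + 1 : ℕ) : ℝ≥0∞)⁻¹)
            (ENNReal.inv_le_one.2 (by exact_mod_cast Nat.succ_le_succ (Nat.zero_le m)))).bind
          fun halt => if halt then PMF.pure (c.1, true)
            else (forward G c.1).map fun c' => (c', false)).bind (extendOne m)

theorem extendRounds_eq (m : ℕ) (l : List (Coupon V × Bool)) :
    extendRounds G m l = drawEach (extendOne G m) l := by
  induction m generalizing l with
  | zero => exact (drawEach_pure l).symm
  | succ m ih =>
    rw [extendRounds, extendRound, funext ih, drawEach_bind]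
    rfl

theorem extendOne_true (m : ℕ) (c : Coupon V) :
    extendOne G m (c, true) = PMF.pure (c, true) := by
  induction m with
  | zero => rfl
  | succ m ih => simp only [extendOne, if_true, PMF.pure_bind, ih]

/-- A moving coupon makes `0` extra steps with probability `1 / (m + 1)`, and otherwise one step
more than a uniform number in `[0, m - 1]`: the number of extra steps is uniform in `[0, m]`. The
factor `m` replaces a division that would be wrong for `m = 0`. -/
theorem mean_extendOne_false (m : ℕ) (c : Coupon V) (g : Coupon V → ℝ≥0∞) :
    (m : ℝ≥0∞) * mean (extendOne G m (c, false)) (fun c' => g c'.1) =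
      ∑ r ∈ Finset.range m, mean (forwards G r c) g := by
  induction m generalizing c with
  | zero => simp only [Nat.cast_zero, zero_mul, Finset.range_zero, Finset.sum_empty]
  | succ m ih =>
    have mul_halt : ((m + 1 : ℕ) : ℝ≥0∞) * ((m + 1 : ℕ) : ℝ≥0∞)⁻¹ = 1 :=
      ENNReal.mul_inv_cancel (by exact_mod_cast m.succ_ne_zero) (ENNReal.natCast_ne_top _)
    have mul_move : ((m + 1 : ℕ) : ℝ≥0∞) * (1 - ((m + 1 : ℕ) : ℝ≥0∞)⁻¹) = m := by
      rw [ENNReal.mul_sub fun _ _ => ENNReal.natCast_ne_top _, mul_halt, mul_one, Nat.cast_add,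
        Nat.cast_one, ENNReal.add_sub_cancel_right ENNReal.one_ne_top]
    calc ((m + 1 : ℕ) : ℝ≥0∞) * mean (extendOne G (m + 1) (c, false)) (fun c' => g c'.1)
        = g c + m * mean (forward G c) fun c' =>
            mean (extendOne G m (c', false)) fun c'' => g c''.1 := by
          simp only [extendOne, Bool.false_eq_true, if_false, if_true, mean_bind, mean_coin,
            extendOne_true, mean_pure, mean_map]
          rw [mul_add, ← mul_assoc, ← mul_assoc, mul_halt, mul_move, one_mul]
      _ = g c + ∑ r ∈ Finset.range m, mean (forwards G (r + 1) c) g := by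
          simp only [← mean_const_mul, ih, mean_sum, forwards_succ', mean_bind]
      _ = ∑ r ∈ Finset.range (m + 1), mean (forwards G r c) g := by
          rw [Finset.sum_range_succ', forwards_zero, mean_pure, add_comm]

theorem sendMoreCoupons_eq (lam eta : ℕ) (hlam : 0 < lam) (x : V) :
    sendMoreCoupons G lam eta x =
      drawMultiset (couponLaw G lam hlam) (Multiset.replicate eta x) := by
  have coupon_eq (y : V) : ((forwards G lam ⟨y, y, 0⟩).bind fun c =>
      extendOne G lam (c, false)).map Prod.fst = couponLaw G lam hlam y := by
    refine ext_mean fun g => ?_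
    simp only [mean_couponLaw, mean_map, mean_bind, forwards_add]
    simp only [← mean_sum, ← mean_extendOne_false, mean_const_mul]
    rw [natCast_inv_mul_cancel_left hlam.ne']
  rw [← Multiset.coe_replicate, ← map_coe_drawEach, ← funext coupon_eq, ← map_drawEach,
    PMF.map_comp, sendMoreCoupons]
  simp only [sendRounds_eq, extendRounds_eq, drawEach_map, drawEach_bind]
  rw [← List.map_replicate (f := fun y : V => (⟨y, y, 0⟩ : Coupon V)), drawEach_map]
  rfl

end Walks

/-! ### Stitching -/

section Stitching

variable {V : Type*} [Fintype V] [DecidableEq V] {G : SimpleGraph V} [DecidableRel G.Adj]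
  {ell eta : ℕ} (lam : ℕ) (hlam : 0 < lam) (bfs : Network V → (x : V) → PMF (BFSTree G x))

theorem drawMultiset_bind_stitch_of_mem {s : Multiset V} {t : Token V} (ht : t.holder ∈ s) :
    ((drawMultiset (couponLaw G lam hlam) s).bind fun net => stitch lam eta bfs net t) =
      (couponLaw G lam hlam t.holder).bind fun c =>
        (drawMultiset (couponLaw G lam hlam) (s.erase t.holder)).map fun net =>
          some (net, ⟨t.src, c.holder, t.done + c.hops⟩) := by
  simp only [stitch, bfs_bind_sampleCoupon, ← PMF.bind_pure_comp]
  exact drawMultiset_bind_uniformPick (src_of_mem_support_couponLaw G lam hlam) ht _ _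
    fun c net => rfl

theorem drawMultiset_bind_stitch_of_notMem (heta : 0 < eta) {s : Multiset V} {t : Token V}
    (ht : t.holder ∉ s) :
    ((drawMultiset (couponLaw G lam hlam) s).bind fun net => stitch lam eta bfs net t) =
      (couponLaw G lam hlam t.holder).bind fun c =>
        (drawMultiset (couponLaw G lam hlam)
          ((s + Multiset.replicate eta t.holder).erase t.holder)).map fun net =>
            some (net, ⟨t.src, c.holder, t.done + c.hops⟩) := by
  have hsrc := src_of_mem_support_couponLaw G lam hlam
  have hmem : t.holder ∈ s + Multiset.replicate eta t.holder :=
    Multiset.mem_add.2 (.inr (Multiset.mem_replicate.2 ⟨heta.ne', rfl⟩))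
  have stitch_eq (net) (hnet : net ∈ (drawMultiset (couponLaw G lam hlam) s).support) :
      stitch lam eta bfs net t =
        ((drawMultiset (couponLaw G lam hlam) (Multiset.replicate eta t.holder)).map
          (net + ·)).bind fun net' => (uniformPick (net'.filter fun c => c.src = t.holder)).map
            fun o => o.map (takeCoupon net' t) := by
    have hcard := card_filter_tag_of_mem_support_drawMultiset hsrc t.holder hnet
    rw [Multiset.count_eq_zero.2 ht, Multiset.card_eq_zero] at hcard
    simp only [stitch, bfs_bind_sampleCoupon, hcard, uniformPick_zero, PMF.pure_bind,
      sendMoreCoupons_eq G lam eta hlam, PMF.bind_map, Function.comp_def]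
  rw [bind_congr_of_mem_support stitch_eq, ← PMF.bind_bind, ← drawMultiset_add]
  simp only [← PMF.bind_pure_comp]
  exact drawMultiset_bind_uniformPick hsrc hmem _ _ fun c net => rfl

theorem exists_drawMultiset_bind_stitch (heta : 0 < eta) (s : Multiset V) (t : Token V) :
    ∃ s' : Multiset V,
      ((drawMultiset (couponLaw G lam hlam) s).bind fun net => stitch lam eta bfs net t) =
        (couponLaw G lam hlam t.holder).bind fun c =>
          (drawMultiset (couponLaw G lam hlam) s').map fun net =>
            some (net, ⟨t.src, c.holder, t.done + c.hops⟩) := by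
  by_cases ht : t.holder ∈ s
  · exact ⟨_, drawMultiset_bind_stitch_of_mem lam hlam bfs ht⟩
  · exact ⟨_, drawMultiset_bind_stitch_of_notMem lam hlam bfs heta ht⟩

theorem phaseTwo_of_lt (fuel : ℕ) (net : Network V) {t : Token V} (ht : ell < t.done + 2 * lam) :
    phaseTwo ell lam eta bfs fuel net t =
      (walk G (ell - t.done) t.holder).map (outputs t.src) := by
  rw [phaseTwo.eq_def]
  exact if_neg ht.not_ge

theorem phaseTwo_succ_of_le (fuel : ℕ) (net : Network V) {t : Token V}
    (ht : t.done + 2 * lam ≤ ell) :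
    phaseTwo ell lam eta bfs (fuel + 1) net t =
      (stitch lam eta bfs net t).bind fun
        | some (net', t') => phaseTwo ell lam eta bfs fuel net' t'
        | none => PMF.pure fun _ => none := by
  rw [phaseTwo.eq_def]
  exact if_pos ht

theorem drawMultiset_bind_phaseTwo (heta : 0 < eta) (fuel : ℕ) (s : Multiset V) (t : Token V)
    (hfuel : ell ≤ t.done + fuel) :
    ((drawMultiset (couponLaw G lam hlam) s).bind fun net =>
        phaseTwo ell lam eta bfs fuel net t) =
      (walk G (ell - t.done) t.holder).map (outputs t.src) := by
  induction fuel generalizing s t with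
  | zero =>
    simp only [phaseTwo_of_lt lam bfs 0 _ (show ell < t.done + 2 * lam by omega), PMF.bind_const]
  | succ fuel ih =>
    rcases lt_or_ge ell (t.done + 2 * lam) with ht | ht
    · simp only [phaseTwo_of_lt lam bfs _ _ ht, PMF.bind_const]
    obtain ⟨s', hs'⟩ := exists_drawMultiset_bind_stitch lam hlam bfs heta s t
    have loop (c : Coupon V) (hc : c ∈ (couponLaw G lam hlam t.holder).support) :
        ((drawMultiset (couponLaw G lam hlam) s').bind fun net =>
          phaseTwo ell lam eta bfs fuel net ⟨t.src, c.holder, t.done + c.hops⟩) =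
        (walk G (ell - t.done - c.hops) c.holder).map (outputs t.src) := by
      have hops_ge := le_hops_of_mem_support_couponLaw G lam hlam _ c hc
      rw [ih s' ⟨t.src, c.holder, t.done + c.hops⟩ (by simp only; omega), Nat.sub_sub]
    simp only [phaseTwo_succ_of_le lam bfs fuel _ ht]
    rw [← PMF.bind_bind, hs']
    simp only [PMF.bind_bind, PMF.bind_map, Function.comp_def]
    rw [bind_congr_of_mem_support loop, ← PMF.map_bind, couponLaw_bind_walk G lam hlam _ (by omega)]

theorem singleRandomWalk_eq (heta : 0 < eta) (s : V) :
    singleRandomWalk ell lam eta hlam bfs s = (walk G ell s).map (outputs s) := by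
  rw [singleRandomWalk, phaseOne_eq, drawMultiset_bind_phaseTwo lam hlam bfs heta ell _ ⟨s, s, 0⟩
    (Nat.le_add_left ell 0), Nat.sub_zero]

end Stitching

end StitchedWalk

theorem mainTheorem3 {V : Type*} [Fintype V] [DecidableEq V] [Nontrivial V]
    (G : SimpleGraph V) [DecidableRel G.Adj] (hG : G.Connected)
    (s : V) (ell lam eta : ℕ) (hlam : 0 < lam) (heta : 0 < eta)
    (bfs : StitchedWalk.Network V → (x : V) → PMF (StitchedWalk.BFSTree G x)) (v : V) :
    (StitchedWalk.singleRandomWalk ell lam eta hlam bfs s).toOuterMeasure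
        {out : V → Option V | out v = some s} =
      StitchedWalk.walk G ell s v := by
  have hout : StitchedWalk.outputs s ⁻¹' {out | out v = some s} = {v} := by
    ext x
    simp [StitchedWalk.outputs, eq_comm]
  rw [StitchedWalk.singleRandomWalk_eq lam hlam bfs heta, PMF.toOuterMeasure_map_apply, hout,
    PMF.toOuterMeasure_apply_singleton]
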